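/- Let $\sigma$ be a probability measure on $\mathbb{R}$ with $\sigma(\{0\})=0$ and finite first moment $\int|x|\,\sigma(dx)<\infty$. Let $(\Delta_k)_{k\ge1}$ be i.i.d. random variables with law $\sigma$ and, independently of them, let $T_k=E_1+\dots+E_k$ ($k\ge1$), where $(E_k)_{k\ge1}$ are i.i.d. exponential random variables with a parameter $\alpha>0$. Write $\lambda$ for Lebesgue measure on $\mathbb{R}$, $\lambda_A$ for its restriction to a Borel set $A$, and $\mu f^{-1}$ for the image of a measure $\mu$ under $f$; the total variation norm of a finite signed measure $\mu$ on $\mathbb{R}$ with Jordan decomposition $\mu=\mu_+-\mu_-$ is $\|\mu\|=\mu_+(\mathbb{R})+\mu_-(\mathbb{R})$. Let $g_n,g\in L^1(\lambda_{\mathbb{R}_+})$ with $g_n\to g$ in $L^1(\lambda_{\mathbb{R}_+})$ as $n\to\infty$. Suppose that $\lambda_{\mathbb{R}_+}g^{-1}\ll\lambda$ and that, for every $t>0$, $$\|\lambda_{[0,t]}g_n^{-1}-\lambda_{[0,t]}g^{-1}\|\longrightarrow0\qquad(n\to\infty).$$ Then the shot noise series $I_n=\sum_{k\ge1}\Delta_k\,g_n(T_k)$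 and $I=\sum_{k\ge1}\Delta_k\,g(T_k)$ converge absolutely almost surely, and their laws satisfy $\|\mathcal{L}(I_n)-\mathcal{L}(I)\|\to0$ as $n\to\infty$. -/

import Mathlib

open MeasureTheory ProbabilityTheory Filter Topology Set

noncomputable section

/-- The total variation norm `‖μ - ν‖ = (μ - ν)₊(ℝ) + (μ - ν)₋(ℝ)` of the difference of two
finite measures on the line, through the Jordan decomposition of the signed measure `μ - ν`. -/
def tvDist (μ ν : Measure ℝ) [IsFiniteMeasure μ] [IsFiniteMeasure ν] : ENNReal :=
  (μ.toSignedMeasure - ν.toSignedMeasure).totalVariation univ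

/-- The jumping times, as partial sums of the waiting times `E`. Indices start from `0`:
`jumpTime E k = E 0 + ⋯ + E k` is the `(k + 1)`-st jumping time. -/
def jumpTime {Ω : Type*} (E : ℕ → Ω → ℝ) (k : ℕ) (ω : Ω) : ℝ :=
  ∑ i ∈ Finset.range (k + 1), E i ω

/-- The terms of the shot noise series with kernel `(t, x) ↦ x * g t`. -/
def shotTerm {Ω : Type*} (Δ E : ℕ → Ω → ℝ) (g : ℝ → ℝ) (ω : Ω) (k : ℕ) : ℝ :=
  Δ k ω * g (jumpTime E k ω)

/-- The sum of the shot noise series with kernel `(t, x) ↦ x * g t`. -/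
def shotNoise {Ω : Type*} (Δ E : ℕ → Ω → ℝ) (g : ℝ → ℝ) (ω : Ω) : ℝ :=
  ∑' k, shotTerm Δ E g ω k

end

/-! Write T₁ < T₂ for the first two jumping times. Given T₂ = t, all jumps and all later waiting
times, T₁ is uniform on [0, t] (`lintegral_first_jumpTime`), and I = Δ₀ g(T₁) + R, where the tail R
is then fixed. Hence P(I ∈ B) is the mean of t⁻¹ λ_{[0,t]}{s | Δ₀ g(s) + R ∈ B}
(`map_shotNoise_apply`).

For fixed x = Δ₀ ≠ 0 this conditional probability depends on g only through the image measure
λ_{[0,t]}g⁻¹ and R. Replacing gₙ by g costs at most a total variation distance, and moving Rₙ to R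
is a small translation of an absolutely continuous measure; both errors vanish even for sets varying
with n (`tendsto_measureReal_affine_sub`).

A Campbell-type bound, E ∑ |Δₖ h(Tₖ)| ≤ α E|Δ₀| ∫ |h|, gives summability and Rₙ → R in L¹, hence
almost surely along subsequences. Dominated convergence concludes, and testing on Hahn sets turns
convergence along arbitrary Bₙ into total variation convergence. -/

/-! ### Total variation distance and translations. -/

section TotalVariation

variable (μ ν : Measure ℝ) [IsFiniteMeasure μ] [IsFiniteMeasure ν]

/-- The difference of two finite measures on a set is bounded by their total variation distance. -/
lemma ofReal_abs_measureReal_sub_le_tvDist {B : Set ℝ} (hB : MeasurableSet B) :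
    ENNReal.ofReal |μ.real B - ν.real B| ≤ tvDist μ ν := by
  rw [← Measure.toSignedMeasure_sub_apply hB,
    SignedMeasure.apply_eq_posPart_real_sub_negPart_real _ hB]
  set s := μ.toSignedMeasure - ν.toSignedMeasure
  have h : |s.toJordanDecomposition.posPart.real B - s.toJordanDecomposition.negPart.real B|
      ≤ s.toJordanDecomposition.posPart.real B + s.toJordanDecomposition.negPart.real B := by
    rw [abs_le]
    constructor <;> linarith [measureReal_nonneg (μ := s.toJordanDecomposition.posPart) (s := B),
      measureReal_nonneg (μ := s.toJordanDecomposition.negPart) (s := B)]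
  refine (ENNReal.ofReal_le_ofReal h).trans ?_
  rw [ENNReal.ofReal_add measureReal_nonneg measureReal_nonneg, ofReal_measureReal,
    ofReal_measureReal]
  exact add_le_add (measure_mono (subset_univ _)) (measure_mono (subset_univ _))

/-- The total variation distance is attained at a Hahn decomposition. -/
lemma exists_tvDist_eq : ∃ B, MeasurableSet B ∧
    tvDist μ ν = ENNReal.ofReal (μ.real B - ν.real B)
      + ENNReal.ofReal (ν.real Bᶜ - μ.real Bᶜ) := by
  obtain ⟨B, hB, hpos, hneg, h₁, h₂⟩ :=
    (μ.toSignedMeasure - ν.toSignedMeasure).toJordanDecomposition_spec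
  refine ⟨B, hB, ?_⟩
  have key (r : ℝ) (hr : 0 ≤ r) : ((NNReal.mk r hr : NNReal) : ENNReal) = ENNReal.ofReal r := by
    rw [ENNReal.ofReal_eq_coe_nnreal hr]
  rw [tvDist, SignedMeasure.totalVariation, Measure.add_apply, h₁, h₂,
    SignedMeasure.toMeasureOfZeroLE_apply _ _ _ MeasurableSet.univ,
    SignedMeasure.toMeasureOfLEZero_apply _ _ _ MeasurableSet.univ, key, key]
  simp only [inter_univ]
  rw [Measure.toSignedMeasure_sub_apply hB, Measure.toSignedMeasure_sub_apply hB.compl, neg_sub]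

end TotalVariation

/-- If the differences vanish in the limit along every sequence of measurable sets, then the
total variation distance tends to zero. -/
lemma tendsto_tvDist_of_forall_measurableSet (μ : ℕ → Measure ℝ) (ν : Measure ℝ)
    [∀ n, IsFiniteMeasure (μ n)] [IsFiniteMeasure ν]
    (h : ∀ B : ℕ → Set ℝ, (∀ n, MeasurableSet (B n)) →
      Tendsto (fun n => (μ n).real (B n) - ν.real (B n)) atTop (𝓝 0)) :
    Tendsto (fun n => tvDist (μ n) ν) atTop (𝓝 0) := by
  choose B hB hB' using fun n => exists_tvDist_eq (μ n) ν
  simp only [hB']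
  have h₁ := ENNReal.tendsto_ofReal (h B hB)
  have h₂ := ENNReal.tendsto_ofReal (h (fun n => (B n)ᶜ) fun n => (hB n).compl).neg
  simpa using h₁.add h₂

/-- Translation is continuous in total variation at a finite absolutely continuous measure. -/
lemma tendsto_measureReal_preimage_add_sub {ρ : Measure ℝ} [IsFiniteMeasure ρ] (hρ : ρ ≪ volume)
    (D : ℕ → Set ℝ) {a : ℕ → ℝ} (ha : Tendsto a atTop (𝓝 0)) :
    Tendsto (fun n => ρ.real ((fun y => y + a n) ⁻¹' D n) - ρ.real (D n)) atTop (𝓝 0) := by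
  set f : ℝ → ℝ := fun x => (ρ.rnDeriv volume x).toReal with hf
  have hfint : Integrable f volume := Measure.integrable_toReal_rnDeriv
  have hρf (D : Set ℝ) : ρ.real D = ∫ x in D, f x :=
    (Measure.setIntegral_toReal_rnDeriv hρ D).symm
  -- The error is at most the L¹ distance between the density and its translate, whatever the sets;
  -- translation acts continuously on L¹.
  let F : Lp ℝ 1 (volume : Measure ℝ) := hfint.toL1 f
  have hF : F =ᵐ[volume] f := hfint.coeFn_toL1
  have : Fact ((1 : ENNReal) ≠ ⊤) := ⟨ENNReal.one_ne_top⟩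
  have hlim : Tendsto (fun n => ‖(DomAddAct.mk (-a n) +ᵥ F) - F‖) atTop (𝓝 0) := by
    have hc : Continuous fun b : ℝ => ‖(DomAddAct.mk b +ᵥ F) - F‖ := by
      have : Continuous fun b : ℝ => DomAddAct.mk b +ᵥ F :=
        (DomAddAct.continuous_mk).vadd continuous_const
      fun_prop
    have := (hc.tendsto 0).comp (by simpa using ha.neg : Tendsto (fun n => -a n) atTop (𝓝 0))
    simpa [Function.comp_def] using this
  refine squeeze_zero_norm (fun n => ?_) hlim
  have hshift : ρ.real ((fun y => y + a n) ⁻¹' D n) = ∫ x in D n, f (-a n + x) := by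
    have := (measurePreserving_add_right volume (a n)).setIntegral_preimage_emb
      (measurableEmbedding_addRight (a n)) (fun x => f (-a n + x)) (D n)
    rw [← this, hρf]
    simp [add_comm]
  have hFshift : (fun x => F (-a n + x)) =ᵐ[volume] fun x => f (-a n + x) :=
    (measurePreserving_add_left volume (-a n)).quasiMeasurePreserving.ae_eq_comp hF
  have hfshift : Integrable (fun x => f (-a n + x)) volume := hfint.comp_add_left (-a n)
  rw [hshift, hρf, ← integral_sub hfshift.integrableOn hfint.integrableOn, L1.norm_eq_integral_norm]
  refine (norm_integral_le_integral_norm _).trans ?_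
  refine (setIntegral_le_integral (hfshift.sub hfint).norm (ae_of_all _ fun _ => norm_nonneg _)).trans
    (le_of_eq (integral_congr_ae ?_))
  filter_upwards [Lp.coeFn_sub (DomAddAct.mk (-a n) +ᵥ F) F,
    DomAddAct.vadd_Lp_ae_eq (DomAddAct.mk (-a n)) F, hF, hFshift] with x h₁ h₂ h₃ h₄
  simp only [Pi.sub_apply, Equiv.symm_apply_apply, vadd_eq_add] at h₁ h₂ ⊢
  rw [h₁, h₂, h₃, h₄]

lemma measurable_setLIntegral_Icc {𝓩 : Type*} [MeasurableSpace 𝓩] {τ : 𝓩 → ℝ} (hτ : Measurable τ)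
    {F : 𝓩 × ℝ → ENNReal} (hF : Measurable F) :
    Measurable fun z => ∫⁻ s in Icc 0 (τ z), F (z, s) := by
  have : (fun z => ∫⁻ s in Icc 0 (τ z), F (z, s))
      = fun z => ∫⁻ s, {p : 𝓩 × ℝ | p.2 ∈ Icc 0 (τ p.1)}.indicator F (z, s) := by
    ext z
    rw [← lintegral_indicator measurableSet_Icc]
    rfl
  rw [this]
  refine Measurable.lintegral_prod_right' (hF.indicator ?_)
  exact (measurableSet_le measurable_const measurable_snd).inter
    (measurableSet_le measurable_snd (hτ.comp measurable_fst))

/-! ### Exponential waiting times and the first two jumping times. -/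

section Exponential

lemma measurable_exponentialPDF (α : ℝ) : Measurable (exponentialPDF α) := by
  unfold exponentialPDF; fun_prop

lemma lintegral_expMeasure (α : ℝ) {h : ℝ → ENNReal} (hh : Measurable h) :
    ∫⁻ x, h x ∂(expMeasure α) = ∫⁻ x, exponentialPDF α x * h x :=
  lintegral_withDensity_eq_lintegral_mul _ (measurable_exponentialPDF α) hh

/-- The renewal equation of the Poisson process, whose renewal measure is `α` times Lebesgue
measure on the half-line. -/
lemma lintegral_expMeasure_add_lintegral_Ici {α : ℝ} (hα : 0 < α) {h : ℝ → ENNReal}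
    (hh : Measurable h) :
    ∫⁻ x, h x ∂(expMeasure α)
      + ENNReal.ofReal α * ∫⁻ s in Ici 0, ∫⁻ u, h (s + u) ∂(expMeasure α)
      = ENNReal.ofReal α * ∫⁻ s in Ici 0, h s := by
  have := isProbabilityMeasure_expMeasure hα
  have hind : Measurable fun p : ℝ × ℝ => (Ici p.1).indicator h p.2 := by
    have : (fun p : ℝ × ℝ => (Ici p.1).indicator h p.2)
        = {p : ℝ × ℝ | p.1 ≤ p.2}.indicator fun p => h p.2 := by
      ext p; simp [indicator]
    rw [this]
    exact (hh.comp measurable_snd).indicator (measurableSet_le measurable_fst measurable_snd)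
  have h₁ : ∫⁻ s in Ici 0, ∫⁻ u, h (s + u) ∂(expMeasure α)
      = ∫⁻ v, h v * ENNReal.ofReal (if 0 ≤ v then 1 - Real.exp (-(α * v)) else 0) := by
    -- Substitute v = s + u: the weight of h v is the probability that an exponential variable is at
    -- most v.
    rw [lintegral_lintegral_swap (by fun_prop)]
    have (u : ℝ) : ∫⁻ s in Ici 0, h (s + u) = ∫⁻ v, (Ici u).indicator h v := by
      rw [← lintegral_indicator measurableSet_Ici, ← lintegral_add_right_eq_self ((Ici u).indicator h) u]
      refine lintegral_congr fun s => ?_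
      simp [indicator]
    simp_rw [this]
    rw [lintegral_lintegral_swap hind.aemeasurable]
    refine lintegral_congr fun v => ?_
    have : (fun u => (Ici u).indicator h v) = (Iic v).indicator fun _ => h v := by
      ext u; simp [indicator]
    rw [this, lintegral_indicator_const measurableSet_Iic, ← lintegral_exponentialPDF_eq_antiDeriv hα]
    congr 1
    exact withDensity_apply _ measurableSet_Iic
  rw [h₁, lintegral_expMeasure α hh, ← lintegral_const_mul' _ _ ENNReal.ofReal_ne_top,
    ← lintegral_const_mul' _ _ ENNReal.ofReal_ne_top, ← lintegral_indicator measurableSet_Ici,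
    ← lintegral_add_left (by have := measurable_exponentialPDF α; fun_prop)]
  refine lintegral_congr fun v => ?_
  by_cases hv : 0 ≤ v
  -- The weights add up to the constant α: α e^{-αv} + α (1 - e^{-αv}) = α.
  · have he : Real.exp (-(α * v)) ≤ 1 := Real.exp_le_one_iff.2 (by nlinarith)
    rw [indicator_of_mem (mem_Ici.2 hv), exponentialPDF_of_nonneg hv, if_pos hv, mul_comm (h v),
      ← mul_assoc, ← ENNReal.ofReal_mul hα.le, ← add_mul, ← ENNReal.ofReal_add (by positivity)
        (mul_nonneg hα.le (by linarith))]
    ring_nf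
  · rw [indicator_of_notMem (by simpa using hv), exponentialPDF_of_neg (not_le.1 hv), if_neg hv]
    simp

/-- The joint law of the first two jumping times. -/
lemma lintegral_expMeasure_expMeasure {α : ℝ} (hα : 0 < α) {f : ℝ × ℝ → ENNReal}
    (hf : Measurable f) :
    ∫⁻ a, ∫⁻ b, f (a, a + b) ∂(expMeasure α) ∂(expMeasure α)
      = ∫⁻ t, ENNReal.ofReal (α * α * Real.exp (-(α * t))) * ∫⁻ s in Icc 0 t, f (s, t) := by
  have := isProbabilityMeasure_expMeasure hα
  have hm := measurable_exponentialPDF α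
  rw [lintegral_expMeasure α (Measurable.lintegral_prod_right'
    (f := fun p : ℝ × ℝ => f (p.1, p.1 + p.2)) (by fun_prop))]
  have h₁ (a : ℝ) : exponentialPDF α a * ∫⁻ b, f (a, a + b) ∂(expMeasure α)
      = ∫⁻ t, exponentialPDF α a * (exponentialPDF α (t - a) * f (a, t)) := by
    rw [lintegral_expMeasure α (by fun_prop), lintegral_const_mul _ (by fun_prop),
      ← lintegral_add_left_eq_self (fun t => exponentialPDF α (t - a) * f (a, t)) a]
    simp
  simp_rw [h₁]
  rw [lintegral_lintegral_swap (by fun_prop)]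
  refine lintegral_congr fun t => ?_
  rw [← lintegral_const_mul' _ _ ENNReal.ofReal_ne_top, ← lintegral_indicator measurableSet_Icc]
  refine lintegral_congr fun a => ?_
  by_cases ha : a ∈ Icc 0 t
  -- The product of the two densities, α² e^{-αt}, does not depend on a; this is the source of the
  -- uniform law.
  · rw [indicator_of_mem ha, exponentialPDF_of_nonneg ha.1,
      exponentialPDF_of_nonneg (sub_nonneg.2 ha.2), ← mul_assoc,
      ← ENNReal.ofReal_mul (by positivity)]
    congr 2
    rw [show -(α * t) = -(α * a) + -(α * (t - a)) by ring, Real.exp_add]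
    ring
  · rw [indicator_of_notMem ha]
    rcases lt_or_ge a 0 with h | h
    · simp [exponentialPDF_of_neg h]
    · have : t - a < 0 := by
        by_contra h'
        exact ha ⟨h, by linarith⟩
      simp [exponentialPDF_of_neg this]

/-- Given the second jumping time `t`, the first one is uniformly distributed on `[0, t]`. -/
lemma lintegral_expMeasure_expMeasure_eq_average {α : ℝ} (hα : 0 < α) {f : ℝ × ℝ → ENNReal}
    (hf : Measurable f) :
    ∫⁻ a, ∫⁻ b, f (a, a + b) ∂(expMeasure α) ∂(expMeasure α)
      = ∫⁻ a, ∫⁻ b, ((ENNReal.ofReal (a + b))⁻¹ * ∫⁻ s in Icc 0 (a + b), f (s, a + b))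
        ∂(expMeasure α) ∂(expMeasure α) := by
  rw [lintegral_expMeasure_expMeasure hα hf]
  have := lintegral_expMeasure_expMeasure hα
    (f := fun p => (ENNReal.ofReal p.2)⁻¹ * ∫⁻ s in Icc 0 p.2, f (s, p.2)) (by
      have h₁ : Measurable fun p : ℝ × ℝ => (ENNReal.ofReal p.2)⁻¹ := by fun_prop
      have h₂ : Measurable fun p : ℝ × ℝ => ∫⁻ s in Icc 0 p.2, f (s, p.2) :=
        measurable_setLIntegral_Icc measurable_snd (F := fun q : (ℝ × ℝ) × ℝ => f (q.2, q.1.2))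
          (by fun_prop)
      exact h₁.mul h₂)
  refine Eq.trans (lintegral_congr fun t => ?_) this.symm
  dsimp only
  rw [lintegral_const, Measure.restrict_apply_univ, Real.volume_Icc, sub_zero]
  -- For t ≤ 0 the interval is null, so the value ⊤ of the inverse is harmless. For t > 0 averaging
  -- a constant over [0, t] changes nothing.
  rcases le_or_gt t 0 with ht | ht
  · have : volume.restrict (Icc 0 t) = 0 := by
      rw [Measure.restrict_eq_zero, Real.volume_Icc, sub_zero, ENNReal.ofReal_of_nonpos ht]
    simp [this]
  · congr 1
    rw [mul_comm, ← mul_assoc, ENNReal.mul_inv_cancel (by simpa using ht) ENNReal.ofReal_ne_top,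
      one_mul]

end Exponential

/-! ### Campbell-type bound and independence of the first two waiting times. -/

section RandomSeries

variable {Ω : Type*} [MeasurableSpace Ω] {P : Measure Ω} [IsProbabilityMeasure P] {α : ℝ}
  {Δ E : ℕ → Ω → ℝ}

lemma measurable_jumpTime (hE : ∀ k, Measurable (E k)) (k : ℕ) : Measurable (jumpTime E k) := by
  unfold jumpTime
  fun_prop

lemma lintegral_comp_prodMk_of_indepFun {𝓧 𝓨 : Type*} [MeasurableSpace 𝓧] [MeasurableSpace 𝓨]
    {X : Ω → 𝓧} {Y : Ω → 𝓨} (hX : Measurable X) (hY : Measurable Y) (hXY : IndepFun X Y P)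
    {f : 𝓧 × 𝓨 → ENNReal} (hf : Measurable f) :
    ∫⁻ ω, f (X ω, Y ω) ∂P = ∫⁻ y, ∫⁻ x, f (x, y) ∂(P.map X) ∂(P.map Y) := by
  have := Measure.isProbabilityMeasure_map (μ := P) hX.aemeasurable
  have := Measure.isProbabilityMeasure_map (μ := P) hY.aemeasurable
  rw [← lintegral_map hf (hX.prodMk hY),
    (indepFun_iff_map_prod_eq_prod_map_map hX.aemeasurable hY.aemeasurable).1 hXY,
    lintegral_prod_symm' _ hf]

lemma lintegral_jumpTime_succ (hα : 0 < α) (hE : ∀ k, Measurable (E k))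
    (hE_law : ∀ k, P.map (E k) = expMeasure α) (hE_indep : iIndepFun E P)
    {h : ℝ → ENNReal} (hh : Measurable h) (k : ℕ) :
    ∫⁻ ω, h (jumpTime E (k + 1) ω) ∂P
      = ∫⁻ ω, (∫⁻ u, h (jumpTime E k ω + u) ∂(expMeasure α)) ∂P := by
  have := isProbabilityMeasure_expMeasure hα
  have hT := measurable_jumpTime hE k
  have hind : IndepFun (E (k + 1)) (jumpTime E k) P := by
    have := (hE_indep.indepFun_sum_range_succ hE (k + 1)).symm
    convert this using 1
    ext ω
    simp [jumpTime]
  have hH : Measurable fun y => ∫⁻ u, h (y + u) ∂(expMeasure α) :=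
    Measurable.lintegral_prod_right' (f := fun p : ℝ × ℝ => h (p.1 + p.2)) (by fun_prop)
  rw [← lintegral_map hH hT, ← hE_law (k + 1),
    ← lintegral_comp_prodMk_of_indepFun (hE _) hT hind (f := fun p : ℝ × ℝ => h (p.2 + p.1))
      (by fun_prop)]
  refine lintegral_congr fun ω => ?_
  rw [jumpTime, Finset.sum_range_succ]
  rfl

/-- The expected number of jumping times is dominated by `α` times Lebesgue measure. -/
lemma tsum_lintegral_jumpTime_le (hα : 0 < α) (hE : ∀ k, Measurable (E k))
    (hE_law : ∀ k, P.map (E k) = expMeasure α) (hE_indep : iIndepFun E P)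
    {h : ℝ → ENNReal} (hh : Measurable h) :
    ∑' k, ∫⁻ ω, h (jumpTime E k ω) ∂P ≤ ENNReal.ofReal α * ∫⁻ s in Ici 0, h s := by
  have := isProbabilityMeasure_expMeasure hα
  refine ENNReal.tsum_le_of_sum_range_le fun n => ?_
  -- The sum without its first term is a shorter sum for h averaged over one more waiting time, so h
  -- must vary in the induction; the renewal equation closes it.
  induction n generalizing h with
  | zero => simp
  | succ n ih =>
    rw [Finset.sum_range_succ']
    simp_rw [lintegral_jumpTime_succ hα hE hE_law hE_indep hh]
    have h₀ : ∫⁻ ω, h (jumpTime E 0 ω) ∂P = ∫⁻ x, h x ∂(expMeasure α) := by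
      rw [← hE_law 0, lintegral_map hh (hE 0)]
      simp [jumpTime]
    rw [h₀, ← lintegral_expMeasure_add_lintegral_Ici hα hh, add_comm]
    gcongr
    exact ih (Measurable.lintegral_prod_right' (f := fun p : ℝ × ℝ => h (p.1 + p.2)) (by fun_prop))

/-- The law of every jumping time is absolutely continuous and carried by the half-line. -/
lemma ae_jumpTime_of_ae (hα : 0 < α) (hE : ∀ k, Measurable (E k))
    (hE_law : ∀ k, P.map (E k) = expMeasure α) (hE_indep : iIndepFun E P)
    {p : ℝ → Prop} (hp : ∀ᵐ s ∂(volume.restrict (Ici (0 : ℝ))), p s) (k : ℕ) :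
    ∀ᵐ ω ∂P, p (jumpTime E k ω) := by
  obtain ⟨N, hN, hNm, hN0⟩ := exists_measurable_superset_of_null (ae_iff.1 hp)
  have h := tsum_lintegral_jumpTime_le hα hE hE_law hE_indep
    (measurable_one.indicator hNm : Measurable (N.indicator (1 : ℝ → ENNReal)))
  rw [lintegral_indicator_one hNm, hN0, mul_zero] at h
  have hk := (ENNReal.tsum_eq_zero.1 (le_antisymm h bot_le)) k
  have hm : Measurable fun ω => N.indicator (1 : ℝ → ENNReal) (jumpTime E k ω) :=
    (measurable_one.indicator hNm).comp (measurable_jumpTime hE k)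
  filter_upwards [(lintegral_eq_zero_iff hm).1 hk] with ω hω
  by_contra hc
  have : jumpTime E k ω ∈ N := hN hc
  simp [this] at hω

/-- Each jump is independent of its jumping time, so the expectation of every term factors, and the
time factors sum to at most the intensity integral. -/
lemma lintegral_tsum_enorm_shotTerm_le {σ : Measure ℝ} (hα : 0 < α)
    (hΔ : ∀ k, Measurable (Δ k)) (hE : ∀ k, Measurable (E k))
    (hΔ_law : ∀ k, P.map (Δ k) = σ) (hE_law : ∀ k, P.map (E k) = expMeasure α)
    (hE_indep : iIndepFun E P) (hΔE : IndepFun (fun ω k => Δ k ω) (fun ω k => E k ω) P)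
    {h : ℝ → ℝ} (hh : Measurable h) :
    ∫⁻ ω, ∑' k, ‖shotTerm Δ E h ω k‖ₑ ∂P
      ≤ (∫⁻ x, ‖x‖ₑ ∂σ) * (ENNReal.ofReal α * ∫⁻ s in Ici 0, ‖h s‖ₑ) := by
  have hT := measurable_jumpTime hE
  have hterm (k : ℕ) : ∫⁻ ω, ‖shotTerm Δ E h ω k‖ₑ ∂P
      = (∫⁻ x, ‖x‖ₑ ∂σ) * ∫⁻ ω, ‖h (jumpTime E k ω)‖ₑ ∂P := by
    have hind : IndepFun (fun ω => ‖Δ k ω‖ₑ) (fun ω => ‖h (jumpTime E k ω)‖ₑ) P :=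
      hΔE.comp (φ := fun d : ℕ → ℝ => ‖d k‖ₑ)
        (ψ := fun e : ℕ → ℝ => ‖h (∑ i ∈ Finset.range (k + 1), e i)‖ₑ) (by fun_prop) (by fun_prop)
    rw [← hΔ_law k, lintegral_map (by fun_prop) (hΔ k),
      ← lintegral_mul_eq_lintegral_mul_lintegral_of_indepFun (by fun_prop)
        (by have := hT k; fun_prop) hind]
    simp [shotTerm]
  have hm (k : ℕ) : Measurable fun ω => ‖shotTerm Δ E h ω k‖ₑ :=
    ((hΔ k).mul (hh.comp (hT k))).enorm
  rw [lintegral_tsum fun k => (hm k).aemeasurable]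
  simp_rw [hterm]
  rw [ENNReal.tsum_mul_left]
  gcongr
  exact tsum_lintegral_jumpTime_le hα hE hE_law hE_indep hh.enorm

/-- The hypotheses amount to joint independence of X, Y and Z, which can be regrouped; Fubini on
test functions makes this precise. -/
lemma indepFun_prodMk_of_indepFun_prodMk {𝓧 𝓨 𝓩 : Type*} [MeasurableSpace 𝓧] [MeasurableSpace 𝓨]
    [MeasurableSpace 𝓩] {X : Ω → 𝓧} {Y : Ω → 𝓨} {Z : Ω → 𝓩} (hX : Measurable X)
    (hY : Measurable Y) (hZ : Measurable Z) (h : IndepFun X (fun ω => (Y ω, Z ω)) P)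
    (hYZ : IndepFun Y Z P) : IndepFun Y (fun ω => (X ω, Z ω)) P := by
  have hXZ : IndepFun X Z P := h.comp measurable_id measurable_snd
  have := Measure.isProbabilityMeasure_map (μ := P) hX.aemeasurable
  have := Measure.isProbabilityMeasure_map (μ := P) hY.aemeasurable
  have := Measure.isProbabilityMeasure_map (μ := P) hZ.aemeasurable
  rw [indepFun_iff_map_prod_eq_prod_map_map hY.aemeasurable (hX.prodMk hZ).aemeasurable]
  rw [indepFun_iff_map_prod_eq_prod_map_map hX.aemeasurable hZ.aemeasurable] at hXZ
  refine Measure.ext_of_lintegral _ fun f hf => ?_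
  rw [lintegral_map hf (by fun_prop), lintegral_comp_prodMk_of_indepFun hX (hY.prodMk hZ) h
      (f := fun q : 𝓧 × 𝓨 × 𝓩 => f (q.2.1, q.1, q.2.2)) (by fun_prop),
    (indepFun_iff_map_prod_eq_prod_map_map hY.aemeasurable hZ.aemeasurable).1 hYZ, hXZ,
    lintegral_prod _ hf.aemeasurable]
  have hm : Measurable fun p : 𝓨 × 𝓩 => ∫⁻ x, f (p.1, x, p.2) ∂(P.map X) :=
    Measurable.lintegral_prod_right'
      (f := fun q : (𝓨 × 𝓩) × 𝓧 => f (q.1.1, q.2, q.1.2)) (by fun_prop)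
  rw [lintegral_prod _ hm.aemeasurable]
  refine lintegral_congr fun y => ?_
  rw [lintegral_prod_symm' _ (by fun_prop)]

/-- The first two waiting times are independent of the jumps and the later waiting times. -/
lemma indepFun_first_two (hΔ : ∀ k, Measurable (Δ k)) (hE : ∀ k, Measurable (E k))
    (hE_indep : iIndepFun E P) (hΔE : IndepFun (fun ω k => Δ k ω) (fun ω k => E k ω) P) :
    IndepFun (fun ω => (E 0 ω, E 1 ω))
      (fun ω => ((fun k => Δ k ω, fun k => E (k + 2) ω) : (ℕ → ℝ) × (ℕ → ℝ))) P := by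
  have mΔ : Measurable fun ω k => Δ k ω := by fun_prop
  have mE : Measurable fun ω k => E k ω := by fun_prop
  have m₁ : Measurable fun ω => (E 0 ω, E 1 ω) := by fun_prop
  have m₂ : Measurable fun ω k => E (k + 2) ω := by fun_prop
  have hEE : IndepFun (fun ω => (E 0 ω, E 1 ω)) (fun ω k => E (k + 2) ω) P := by
    -- Disjoint index blocks of an independent family generate independent σ-algebras.
    have hI := indep_iSup_of_disjoint (fun i => (hE i).comap_le)
      ((iIndepFun_iff_iIndep _ _ _).1 hE_indep) (S := {0, 1}) (T := Ici 2) (by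
        rw [Set.disjoint_left]; rintro a (rfl | rfl) <;> simp)
    rw [IndepFun_iff_Indep]
    refine indep_of_indep_of_le_left (indep_of_indep_of_le_right hI ?_) ?_
    · rw [← measurable_iff_comap_le]
      refine @measurable_pi_lambda _ _ _ (_) _ _ fun k => ?_
      exact Measurable.mono (comap_measurable (E (k + 2)))
        (le_iSup₂_of_le (k + 2) (by simp) le_rfl) le_rfl
    · rw [← measurable_iff_comap_le]
      exact @Measurable.prodMk _ _ _ _ _ (_) _ _ (Measurable.mono (comap_measurable (E 0))
        (le_iSup₂_of_le 0 (by simp) le_rfl) le_rfl)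
        (Measurable.mono (comap_measurable (E 1)) (le_iSup₂_of_le 1 (by simp) le_rfl) le_rfl)
  have hΔ2 : IndepFun (fun ω k => Δ k ω)
      (fun ω => ((E 0 ω, E 1 ω), fun k => E (k + 2) ω)) P :=
    hΔE.comp (φ := id) (ψ := fun e : ℕ → ℝ => ((e 0, e 1), fun k => e (k + 2)))
      measurable_id (by fun_prop)
  exact indepFun_prodMk_of_indepFun_prodMk mΔ m₁ m₂ hΔ2 hEE

end RandomSeries

/-! ### Conditional laws given all but the first jumping time. -/

/-- The tail of a shot noise series from the second jump on, as a function of the second jumping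
time, of the jumps and of the later waiting times. -/
noncomputable def shotRest (g : ℝ → ℝ) (q : ℝ × (ℕ → ℝ) × (ℕ → ℝ)) : ℝ :=
  ∑' k, q.2.1 (k + 1) * g (q.1 + ∑ i ∈ Finset.range k, q.2.2 i)

lemma measurable_shotRest {g : ℝ → ℝ} (hg : Measurable g) : Measurable (shotRest g) :=
  Measurable.tsum fun k => by fun_prop

/-- Convergence of the conditional laws of the shot noise, given everything but the first jumping
time. -/
lemma tendsto_measureReal_affine_sub {g : ℝ → ℝ} {gn : ℕ → ℝ → ℝ} (hg : Measurable g)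
    (hgn : ∀ n, Measurable (gn n)) {μ : Measure ℝ} [IsFiniteMeasure μ] (hac : μ.map g ≪ volume)
    (htv : Tendsto (fun n => tvDist (μ.map (gn n)) (μ.map g)) atTop (𝓝 0))
    {x : ℝ} (hx : x ≠ 0) {r : ℕ → ℝ} {r₀ : ℝ} (hr : Tendsto r atTop (𝓝 r₀))
    {B : ℕ → Set ℝ} (hB : ∀ n, MeasurableSet (B n)) :
    Tendsto (fun n => μ.real {s | x * gn n s + r n ∈ B n} - μ.real {s | x * g s + r₀ ∈ B n})
      atTop (𝓝 0) := by
  have hC (n : ℕ) (c : ℝ) : MeasurableSet {y : ℝ | x * y + c ∈ B n} :=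
    (by fun_prop : Measurable fun y : ℝ => x * y + c) (hB n)
  have hpre (n : ℕ) (c : ℝ) {f : ℝ → ℝ} (hf : Measurable f) :
      μ.real {s | x * f s + c ∈ B n} = (μ.map f).real {y | x * y + c ∈ B n} := by
    rw [map_measureReal_apply hf (hC n c)]
    rfl
  -- The test sets move with n, but the total variation distance bounds the difference uniformly
  -- over sets.
  have h₁ : Tendsto (fun n => (μ.map (gn n)).real {y | x * y + r n ∈ B n}
      - (μ.map g).real {y | x * y + r n ∈ B n}) atTop (𝓝 0) := by
    rw [tendsto_zero_iff_abs_tendsto_zero]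
    have : Tendsto (fun n => ENNReal.ofReal |(μ.map (gn n)).real {y | x * y + r n ∈ B n}
      - (μ.map g).real {y | x * y + r n ∈ B n}|) atTop (𝓝 0) :=
      tendsto_of_tendsto_of_tendsto_of_le_of_le tendsto_const_nhds htv (fun _ => zero_le)
        fun n => ofReal_abs_measureReal_sub_le_tvDist _ _ (hC n (r n))
    have := (ENNReal.tendsto_toReal ENNReal.zero_ne_top).comp this
    simpa [Function.comp_def] using this
  -- Since x ≠ 0, changing r₀ into r n amounts to translating y by (r n - r₀) / x.
  have ha : Tendsto (fun n => (r n - r₀) / x) atTop (𝓝 0) := by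
    simpa using (hr.sub_const r₀).div_const x
  have h₂ := tendsto_measureReal_preimage_add_sub hac (fun n => {y | x * y + r₀ ∈ B n}) ha
  have hset (n : ℕ) : (fun y => y + (r n - r₀) / x) ⁻¹' {y | x * y + r₀ ∈ B n}
      = {y | x * y + r n ∈ B n} := by
    ext y
    have : x * (y + (r n - r₀) / x) + r₀ = x * y + r n := by
      field_simp
      ring
    simp [this]
  simp_rw [hset] at h₂
  simp_rw [hpre _ _ hg, fun n c => hpre n c (hgn n)]
  simpa using h₁.add h₂

section Pathwise

variable {Ω : Type*} {Δ E : ℕ → Ω → ℝ}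

/-- The conditional probability that the shot noise lies in `B`, given all the data except
the position of the first jumping time in `[0, E 0 + E 1]`. -/
noncomputable def shotCondProb (Δ E : ℕ → Ω → ℝ) (g : ℝ → ℝ) (B : Set ℝ) (ω : Ω) : ENNReal :=
  (ENNReal.ofReal (E 0 ω + E 1 ω))⁻¹ * volume.restrict (Icc 0 (E 0 ω + E 1 ω))
    {s | Δ 0 ω * g s + shotRest g (E 0 ω + E 1 ω, fun k => Δ k ω, fun k => E (k + 2) ω) ∈ B}

lemma shotCondProb_le_one (g : ℝ → ℝ) (B : Set ℝ) (ω : Ω) : shotCondProb Δ E g B ω ≤ 1 := by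
  refine le_trans (mul_le_mul_right (measure_mono (subset_univ _)) _) ?_
  rw [Measure.restrict_apply_univ, Real.volume_Icc, sub_zero]
  exact ENNReal.inv_mul_le_one _

lemma jumpTime_succ_eq (k : ℕ) (ω : Ω) :
    jumpTime E (k + 1) ω = E 0 ω + E 1 ω + ∑ i ∈ Finset.range k, E (i + 2) ω := by
  rw [jumpTime, Finset.sum_range_succ', Finset.sum_range_succ']
  ring

lemma shotRest_eq (g : ℝ → ℝ) (ω : Ω) :
    shotRest g (E 0 ω + E 1 ω, fun k => Δ k ω, fun k => E (k + 2) ω)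
      = ∑' k, shotTerm Δ E g ω (k + 1) := by
  simp only [shotRest, shotTerm, jumpTime_succ_eq]

/-- Summability matters: a divergent `tsum` is 0, and splitting off the first term would fail. -/
lemma shotNoise_eq {g : ℝ → ℝ} {ω : Ω} (h : Summable (shotTerm Δ E g ω)) :
    shotNoise Δ E g ω = Δ 0 ω * g (E 0 ω)
      + shotRest g (E 0 ω + E 1 ω, fun k => Δ k ω, fun k => E (k + 2) ω) := by
  rw [shotNoise, h.tsum_eq_zero_add, shotRest_eq]
  simp [shotTerm, jumpTime]

end Pathwise

/-! ### Disintegration of the law over the first jumping time. -/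

section RandomSeries

variable {Ω : Type*} [MeasurableSpace Ω] {P : Measure Ω} [IsProbabilityMeasure P] {α : ℝ}
  {Δ E : ℕ → Ω → ℝ}

/-- Given the second jumping time and independent data, the first jumping time is uniform. -/
lemma lintegral_first_jumpTime {𝓦 : Type*} [MeasurableSpace 𝓦] (hα : 0 < α)
    (hE : ∀ k, Measurable (E k)) (hE_law : ∀ k, P.map (E k) = expMeasure α)
    (hE_indep : iIndepFun E P) {W : Ω → 𝓦} (hW : Measurable W)
    (hEW : IndepFun (fun ω => (E 0 ω, E 1 ω)) W P) {f : ℝ × ℝ × 𝓦 → ENNReal} (hf : Measurable f) :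
    ∫⁻ ω, f (E 0 ω, E 0 ω + E 1 ω, W ω) ∂P
      = ∫⁻ ω, ((ENNReal.ofReal (E 0 ω + E 1 ω))⁻¹
        * ∫⁻ s in Icc 0 (E 0 ω + E 1 ω), f (s, E 0 ω + E 1 ω, W ω)) ∂P := by
  have := isProbabilityMeasure_expMeasure hα
  have hEE : Measurable fun ω => (E 0 ω, E 1 ω) := by fun_prop
  have hlaw : P.map (fun ω => (E 0 ω, E 1 ω)) = (expMeasure α).prod (expMeasure α) := by
    rw [(indepFun_iff_map_prod_eq_prod_map_map (hE 0).aemeasurable (hE 1).aemeasurable).1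
      (hE_indep.indepFun zero_ne_one), hE_law, hE_law]
  have hF : Measurable fun q : (ℝ × ℝ) × 𝓦 => (ENNReal.ofReal (q.1.1 + q.1.2))⁻¹
      * ∫⁻ s in Icc 0 (q.1.1 + q.1.2), f (s, q.1.1 + q.1.2, q.2) := by
    have h₁ : Measurable fun q : (ℝ × ℝ) × 𝓦 => (ENNReal.ofReal (q.1.1 + q.1.2))⁻¹ := by fun_prop
    exact h₁.mul (measurable_setLIntegral_Icc (by fun_prop)
      (F := fun z : ((ℝ × ℝ) × 𝓦) × ℝ => f (z.2, z.1.1.1 + z.1.1.2, z.1.2)) (by fun_prop))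
  have h₁ := lintegral_comp_prodMk_of_indepFun hEE hW hEW
    (f := fun q : (ℝ × ℝ) × 𝓦 => f (q.1.1, q.1.1 + q.1.2, q.2)) (by fun_prop)
  have h₂ := lintegral_comp_prodMk_of_indepFun hEE hW hEW hF
  -- Independence allows W to be frozen at w, leaving only the two exponential variables.
  refine h₁.trans (Eq.trans (lintegral_congr fun w => ?_) h₂.symm)
  rw [hlaw, lintegral_prod _ (by fun_prop)]
  exact (lintegral_expMeasure_expMeasure_eq_average hα (f := fun p => f (p.1, p.2, w))
    (by fun_prop)).trans (lintegral_prod _ (hF.comp measurable_prodMk_right).aemeasurable).symm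

lemma measurable_shotCondProb (hΔ : ∀ k, Measurable (Δ k)) (hE : ∀ k, Measurable (E k))
    {g : ℝ → ℝ} (hg : Measurable g) {B : Set ℝ} (hB : MeasurableSet B) :
    Measurable (shotCondProb Δ E g B) := by
  have hR := measurable_shotRest hg
  have hS : MeasurableSet {p : Ω × ℝ | Δ 0 p.1 * g p.2 + shotRest g
      (E 0 p.1 + E 1 p.1, fun k => Δ k p.1, fun k => E (k + 2) p.1) ∈ B} :=
    (by fun_prop : Measurable fun p : Ω × ℝ => Δ 0 p.1 * g p.2 + shotRest g
      (E 0 p.1 + E 1 p.1, fun k => Δ k p.1, fun k => E (k + 2) p.1)) hB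
  have h := measurable_setLIntegral_Icc ((hE 0).add (hE 1))
    ((measurable_one (α := ENNReal)).indicator hS)
  have h₁ : Measurable fun ω => (ENNReal.ofReal (E 0 ω + E 1 ω))⁻¹ := by fun_prop
  refine h₁.mul ?_
  convert h using 2 with ω
  exact (lintegral_indicator_one (measurable_prodMk_left hS)).symm

/-- The law of the shot noise, disintegrated over the position of the first jumping time. -/
lemma map_shotNoise_apply (hα : 0 < α) (hΔ : ∀ k, Measurable (Δ k)) (hE : ∀ k, Measurable (E k))
    (hE_law : ∀ k, P.map (E k) = expMeasure α) (hE_indep : iIndepFun E P)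
    (hΔE : IndepFun (fun ω k => Δ k ω) (fun ω k => E k ω) P) {g : ℝ → ℝ} (hg : Measurable g)
    (hsum : ∀ᵐ ω ∂P, Summable (shotTerm Δ E g ω)) (hm : Measurable (shotNoise Δ E g))
    {B : Set ℝ} (hB : MeasurableSet B) :
    P.map (shotNoise Δ E g) B = ∫⁻ ω, shotCondProb Δ E g B ω ∂P := by
  have hR := measurable_shotRest hg
  have hS : MeasurableSet {p : ℝ × ℝ × (ℕ → ℝ) × (ℕ → ℝ) |
      p.2.2.1 0 * g p.1 + shotRest g p.2 ∈ B} :=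
    (by fun_prop : Measurable fun p : ℝ × ℝ × (ℕ → ℝ) × (ℕ → ℝ) =>
      p.2.2.1 0 * g p.1 + shotRest g p.2) hB
  have h := lintegral_first_jumpTime hα hE hE_law hE_indep
    (W := fun ω => ((fun k => Δ k ω, fun k => E (k + 2) ω) : (ℕ → ℝ) × (ℕ → ℝ))) (by fun_prop)
    (indepFun_first_two hΔ hE hE_indep hΔE) ((measurable_one (α := ENNReal)).indicator hS)
  rw [← lintegral_indicator_one hB, lintegral_map (measurable_one.indicator hB) hm]
  refine Eq.trans (lintegral_congr_ae ?_) (h.trans (lintegral_congr fun ω => ?_))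
  · filter_upwards [hsum] with ω hω
    rw [shotNoise_eq hω]
    rfl
  · rw [shotCondProb]
    congr 1
    exact lintegral_indicator_one (measurable_prodMk_right hS)

end RandomSeries

/-! ### Convergence of the tails and of the laws. -/

section RandomSeries

variable {Ω : Type*} [MeasurableSpace Ω] {P : Measure Ω} [IsProbabilityMeasure P] {α : ℝ}
  {Δ E : ℕ → Ω → ℝ} {σ : Measure ℝ}

lemma measurable_shotNoise (hΔ : ∀ k, Measurable (Δ k)) (hE : ∀ k, Measurable (E k))
    {g : ℝ → ℝ} (hg : Measurable g) : Measurable (shotNoise Δ E g) :=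
  Measurable.tsum fun k => (hΔ k).mul (hg.comp (measurable_jumpTime hE k))

lemma ae_summable_shotTerm (hσ : Integrable (fun x : ℝ => x) σ) (hα : 0 < α)
    (hΔ : ∀ k, Measurable (Δ k)) (hE : ∀ k, Measurable (E k))
    (hΔ_law : ∀ k, P.map (Δ k) = σ) (hE_law : ∀ k, P.map (E k) = expMeasure α)
    (hE_indep : iIndepFun E P) (hΔE : IndepFun (fun ω k => Δ k ω) (fun ω k => E k ω) P)
    {g : ℝ → ℝ} (hg : Measurable g) (hgi : IntegrableOn g (Ici 0)) :
    ∀ᵐ ω ∂P, Summable (shotTerm Δ E g ω) := by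
  have hle := lintegral_tsum_enorm_shotTerm_le hα hΔ hE hΔ_law hE_law hE_indep hΔE hg
  have hlt : ∫⁻ ω, ∑' k, ‖shotTerm Δ E g ω k‖ₑ ∂P ≠ ⊤ :=
    ne_top_of_le_ne_top (ENNReal.mul_ne_top hσ.2.ne
      (ENNReal.mul_ne_top ENNReal.ofReal_ne_top hgi.2.ne)) hle
  have hm : Measurable fun ω => ∑' k, ‖shotTerm Δ E g ω k‖ₑ :=
    Measurable.tsum fun k => ((hΔ k).mul (hg.comp (measurable_jumpTime hE k))).enorm
  filter_upwards [ae_lt_top hm hlt] with ω hω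
  exact Summable.of_enorm hω.ne

/-- Kernels that converge in `L¹` have tails that converge in `L¹`. -/
lemma tendsto_eLpNorm_shotRest_sub (hσ : Integrable (fun x : ℝ => x) σ) (hα : 0 < α)
    (hΔ : ∀ k, Measurable (Δ k)) (hE : ∀ k, Measurable (E k))
    (hΔ_law : ∀ k, P.map (Δ k) = σ) (hE_law : ∀ k, P.map (E k) = expMeasure α)
    (hE_indep : iIndepFun E P) (hΔE : IndepFun (fun ω k => Δ k ω) (fun ω k => E k ω) P)
    {g : ℝ → ℝ} {gn : ℕ → ℝ → ℝ} (hg : Measurable g) (hgn : ∀ n, Measurable (gn n))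
    (hgi : IntegrableOn g (Ici 0)) (hgni : ∀ n, IntegrableOn (gn n) (Ici 0))
    (hconv : Tendsto (fun n => eLpNorm (gn n - g) 1 (volume.restrict (Ici 0))) atTop (𝓝 0)) :
    Tendsto (fun n => eLpNorm ((fun ω => shotRest (gn n)
        (E 0 ω + E 1 ω, fun k => Δ k ω, fun k => E (k + 2) ω))
      - fun ω => shotRest g (E 0 ω + E 1 ω, fun k => Δ k ω, fun k => E (k + 2) ω)) 1 P)
      atTop (𝓝 0) := by
  have hlim : Tendsto (fun n => (∫⁻ x, ‖x‖ₑ ∂σ) *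
      (ENNReal.ofReal α * eLpNorm (gn n - g) 1 (volume.restrict (Ici 0)))) atTop (𝓝 0) := by
    have h₁ := ENNReal.Tendsto.const_mul (a := ENNReal.ofReal α) hconv
      (Or.inr ENNReal.ofReal_ne_top)
    have h₂ := ENNReal.Tendsto.const_mul (a := ∫⁻ x, ‖x‖ₑ ∂σ) h₁ (Or.inr hσ.2.ne)
    simpa using h₂
  refine tendsto_of_tendsto_of_tendsto_of_le_of_le tendsto_const_nhds hlim (fun _ => zero_le)
    fun n => ?_
  simp only [eLpNorm_one_eq_lintegral_enorm]
  -- By linearity the difference of the tails is the tail of the series with kernel gn n - g,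
  -- dominated by its full series of absolute values.
  refine le_trans (lintegral_mono_ae ?_) (lintegral_tsum_enorm_shotTerm_le hα hΔ hE hΔ_law hE_law
    hE_indep hΔE ((hgn n).sub hg))
  filter_upwards [ae_summable_shotTerm hσ hα hΔ hE hΔ_law hE_law hE_indep hΔE hg hgi,
    ae_summable_shotTerm hσ hα hΔ hE hΔ_law hE_law hE_indep hΔE (hgn n) (hgni n)] with ω h₁ h₂
  have h₁' := (summable_nat_add_iff 1).2 h₁
  have h₂' := (summable_nat_add_iff 1).2 h₂
  rw [Pi.sub_apply, shotRest_eq, shotRest_eq, ← h₂'.tsum_sub h₁']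
  refine enorm_tsum_le_tsum_enorm.trans ?_
  refine le_trans (le_of_eq (tsum_congr fun k => ?_))
    (ENNReal.tsum_comp_le_tsum_of_injective (add_left_injective 1) _)
  simp [shotTerm, mul_sub]

/-- Convergence on measurable sets when the tails converge almost surely. -/
lemma tendsto_map_shotNoise_sub_of_ae (hσ_zero : σ {0} = 0) (hσ : Integrable (fun x : ℝ => x) σ)
    (hα : 0 < α) (hΔ : ∀ k, Measurable (Δ k)) (hE : ∀ k, Measurable (E k))
    (hΔ_law : ∀ k, P.map (Δ k) = σ) (hE_law : ∀ k, P.map (E k) = expMeasure α)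
    (hE_indep : iIndepFun E P) (hΔE : IndepFun (fun ω k => Δ k ω) (fun ω k => E k ω) P)
    {g : ℝ → ℝ} {gn : ℕ → ℝ → ℝ} (hg : Measurable g) (hgn : ∀ n, Measurable (gn n))
    (hgi : IntegrableOn g (Ici 0)) (hgni : ∀ n, IntegrableOn (gn n) (Ici 0))
    (hac : (volume.restrict (Ici (0 : ℝ))).map g ≪ volume)
    (htv : ∀ t : ℝ, 0 < t →
      Tendsto (fun n => tvDist ((volume.restrict (Icc 0 t)).map (gn n))
        ((volume.restrict (Icc 0 t)).map g)) atTop (𝓝 0))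
    (hrest : ∀ᵐ ω ∂P, Tendsto (fun n => shotRest (gn n)
        (E 0 ω + E 1 ω, fun k => Δ k ω, fun k => E (k + 2) ω)) atTop
      (𝓝 (shotRest g (E 0 ω + E 1 ω, fun k => Δ k ω, fun k => E (k + 2) ω))))
    {B : ℕ → Set ℝ} (hB : ∀ n, MeasurableSet (B n)) :
    Tendsto (fun n => (P.map (shotNoise Δ E (gn n))).real (B n)
      - (P.map (shotNoise Δ E g)).real (B n)) atTop (𝓝 0) := by
  have hpos : ∀ᵐ ω ∂P, 0 < E 0 ω + E 1 ω := by
    have h₀ : ∀ᵐ s ∂(volume.restrict (Ici (0 : ℝ))), 0 < s := by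
      rw [← restrict_Ioi_eq_restrict_Ici]
      exact ae_restrict_mem measurableSet_Ioi
    filter_upwards [ae_jumpTime_of_ae hα hE hE_law hE_indep h₀ 1] with ω hω
    simpa [jumpTime, Finset.sum_range_succ] using hω
  have hne : ∀ᵐ ω ∂P, Δ 0 ω ≠ 0 := by
    have h := hσ_zero
    rw [← hΔ_law 0, Measure.map_apply (hΔ 0) (measurableSet_singleton 0)] at h
    exact compl_mem_ae_iff.2 h
  have hint {f : ℝ → ℝ} (hf : Measurable f) (n : ℕ) :
      Integrable (fun ω => (shotCondProb Δ E f (B n) ω).toReal) P :=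
    Integrable.of_bound (measurable_shotCondProb hΔ hE hf (hB n)).ennreal_toReal.aestronglyMeasurable
      1 (ae_of_all _ fun ω => by
        rw [Real.norm_of_nonneg ENNReal.toReal_nonneg]
        exact ENNReal.toReal_le_of_le_ofReal zero_le_one
          (by simpa using shotCondProb_le_one f (B n) ω))
  have hreal {f : ℝ → ℝ} (hf : Measurable f) (hfi : IntegrableOn f (Ici 0)) (n : ℕ) :
      (P.map (shotNoise Δ E f)).real (B n) = ∫ ω, (shotCondProb Δ E f (B n) ω).toReal ∂P := by
    rw [integral_toReal (measurable_shotCondProb hΔ hE hf (hB n)).aemeasurable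
      (ae_of_all _ fun ω => (shotCondProb_le_one f (B n) ω).trans_lt ENNReal.one_lt_top),
      measureReal_def, map_shotNoise_apply hα hΔ hE hE_law hE_indep hΔE hf
        (ae_summable_shotTerm hσ hα hΔ hE hΔ_law hE_law hE_indep hΔE hf hfi)
        (measurable_shotNoise hΔ hE hf) (hB n)]
  simp_rw [hreal hg hgi, fun n => hreal (hgn n) (hgni n) n, ← integral_sub (hint (hgn _) _)
    (hint hg _)]
  rw [show (0 : ℝ) = ∫ _, (0 : ℝ) ∂P by simp]
  refine tendsto_integral_of_dominated_convergence (fun _ => 1)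
    (fun n => ((hint (hgn n) n).sub (hint hg n)).aestronglyMeasurable) (integrable_const _)
    (fun n => ae_of_all _ fun ω => ?_) ?_
  · have hb (f : ℝ → ℝ) : (shotCondProb Δ E f (B n) ω).toReal ∈ Icc (0 : ℝ) 1 :=
      ⟨ENNReal.toReal_nonneg, ENNReal.toReal_le_of_le_ofReal zero_le_one
          (by simpa using shotCondProb_le_one f (B n) ω)⟩
    rw [Real.norm_eq_abs, abs_le]
    constructor <;> linarith [(hb (gn n)).1, (hb (gn n)).2, (hb g).1, (hb g).2]
  · filter_upwards [hpos, hne, hrest] with ω hT hx hr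
    have hac' : (volume.restrict (Icc 0 (E 0 ω + E 1 ω))).map g ≪ volume :=
      (((Measure.restrict_mono Icc_subset_Ici_self le_rfl).absolutelyContinuous).map hg).trans hac
    have h := (tendsto_measureReal_affine_sub hg hgn hac' (htv _ hT) hx hr hB).const_mul
      (E 0 ω + E 1 ω)⁻¹
    simpa only [shotCondProb, ENNReal.toReal_mul, ENNReal.toReal_inv,
      ENNReal.toReal_ofReal hT.le, measureReal_def, mul_sub, mul_zero] using h

/-- Total variation convergence of shot noise series with measurable data. -/
lemma tendsto_tvDist_map_shotNoise (hσ_zero : σ {0} = 0) (hσ : Integrable (fun x : ℝ => x) σ)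
    (hα : 0 < α) (hΔ : ∀ k, Measurable (Δ k)) (hE : ∀ k, Measurable (E k))
    (hΔ_law : ∀ k, P.map (Δ k) = σ) (hE_law : ∀ k, P.map (E k) = expMeasure α)
    (hE_indep : iIndepFun E P) (hΔE : IndepFun (fun ω k => Δ k ω) (fun ω k => E k ω) P)
    {g : ℝ → ℝ} {gn : ℕ → ℝ → ℝ} (hg : Measurable g) (hgn : ∀ n, Measurable (gn n))
    (hgi : IntegrableOn g (Ici 0)) (hgni : ∀ n, IntegrableOn (gn n) (Ici 0))
    (hconv : Tendsto (fun n => eLpNorm (gn n - g) 1 (volume.restrict (Ici 0))) atTop (𝓝 0))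
    (hac : (volume.restrict (Ici (0 : ℝ))).map g ≪ volume)
    (htv : ∀ t : ℝ, 0 < t →
      Tendsto (fun n => tvDist ((volume.restrict (Icc 0 t)).map (gn n))
        ((volume.restrict (Icc 0 t)).map g)) atTop (𝓝 0)) :
    Tendsto (fun n => tvDist (P.map (shotNoise Δ E (gn n))) (P.map (shotNoise Δ E g)))
      atTop (𝓝 0) := by
  refine tendsto_tvDist_of_forall_measurableSet _ _ fun B hB => ?_
  -- L¹ convergence of the tails yields almost sure convergence only along subsequences; it suffices
  -- that every subsequence has a further one along which the limit holds.
  refine tendsto_of_subseq_tendsto fun ns hns => ?_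
  have hRm {f : ℝ → ℝ} (hf : Measurable f) : Measurable fun ω =>
      shotRest f (E 0 ω + E 1 ω, fun k => Δ k ω, fun k => E (k + 2) ω) := by
    have := measurable_shotRest hf
    fun_prop
  have hmeas := tendstoInMeasure_of_tendsto_eLpNorm one_ne_zero
    (fun n => (hRm (hgn (ns n))).aestronglyMeasurable) (hRm hg).aestronglyMeasurable
    ((tendsto_eLpNorm_shotRest_sub hσ hα hΔ hE hΔ_law hE_law hE_indep hΔE hg hgn hgi hgni
      hconv).comp hns)
  obtain ⟨ms, hms, hae⟩ := hmeas.exists_seq_tendsto_ae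
  exact ⟨ms, tendsto_map_shotNoise_sub_of_ae hσ_zero hσ hα hΔ hE hΔ_law hE_law hE_indep hΔE hg
    (fun n => hgn _) hgi (fun n => hgni _) hac
    (fun t ht => (htv t ht).comp (hns.comp hms.tendsto_atTop)) hae (fun n => hB _)⟩

/-- Almost surely, a shot noise series depends only on the almost everywhere classes of its
data. -/
lemma ae_shotTerm_eq {Δ' E' : ℕ → Ω → ℝ} (hα : 0 < α) (hE : ∀ k, Measurable (E k))
    (hE_law : ∀ k, P.map (E k) = expMeasure α) (hE_indep : iIndepFun E P)
    (hΔ' : ∀ k, Δ' k =ᵐ[P] Δ k) (hE' : ∀ k, E' k =ᵐ[P] E k) {g g' : ℝ → ℝ}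
    (hgg : g' =ᵐ[volume.restrict (Ici 0)] g) :
    ∀ᵐ ω ∂P, shotTerm Δ' E' g' ω = shotTerm Δ E g ω := by
  filter_upwards [ae_all_iff.2 hΔ', ae_all_iff.2 hE',
    ae_all_iff.2 (ae_jumpTime_of_ae hα hE hE_law hE_indep hgg)] with ω h₁ h₂ h₃
  ext k
  simp only [shotTerm, h₁, ← h₃]
  simp only [jumpTime, h₂]

end RandomSeries

/-- Summability in ℝ is absolute. Almost everywhere measurability belongs to the conclusion because
`Measure.map` is zero without it. -/
theorem corollary2 {Ω : Type*} [MeasurableSpace Ω] (P : Measure Ω) [IsProbabilityMeasure P]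
    (σ : Measure ℝ) [IsProbabilityMeasure σ] (hσ_zero : σ {0} = 0)
    (hσ_moment : Integrable (fun x : ℝ => x) σ)
    (α : ℝ) (hα : 0 < α) (Δ E : ℕ → Ω → ℝ)
    -- the jumps are i.i.d. with law `σ`
    (hΔ_law : ∀ k, HasLaw (Δ k) σ P) (hΔ_indep : iIndepFun Δ P)
    -- the waiting times are i.i.d. exponential
    (hE_law : ∀ k, HasLaw (E k) (expMeasure α) P) (hE_indep : iIndepFun E P)
    -- the two sequences are independent
    (hΔE : IndepFun (fun ω k => Δ k ω) (fun ω k => E k ω) P)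
    (g : ℝ → ℝ) (gn : ℕ → ℝ → ℝ)
    (hg : IntegrableOn g (Ici 0)) (hgn : ∀ n, IntegrableOn (gn n) (Ici 0))
    (hconv : Tendsto (fun n => eLpNorm (gn n - g) 1 (volume.restrict (Ici 0))) atTop (𝓝 0))
    (hac : (volume.restrict (Ici (0 : ℝ))).map g ≪ volume)
    (htv : ∀ t : ℝ, 0 < t →
      Tendsto (fun n => tvDist ((volume.restrict (Icc 0 t)).map (gn n))
        ((volume.restrict (Icc 0 t)).map g)) atTop (𝓝 0)) :
    -- the series defining `I_n` and `I` converge almost surely to random variables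
    (∀ n, (∀ᵐ ω ∂P, Summable (shotTerm Δ E (gn n) ω)) ∧ AEMeasurable (shotNoise Δ E (gn n)) P) ∧
    ((∀ᵐ ω ∂P, Summable (shotTerm Δ E g ω)) ∧ AEMeasurable (shotNoise Δ E g) P) ∧
    -- the laws converge in total variation
    Tendsto (fun n => tvDist (P.map (shotNoise Δ E (gn n))) (P.map (shotNoise Δ E g)))
      atTop (𝓝 0) := by
  -- The data are only almost everywhere measurable. Measurable versions give almost surely the same
  -- series, because the jumping times avoid Lebesgue null sets.
  choose Δ' mΔ' hΔ' using fun k => (hΔ_law k).aemeasurable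
  choose E' mE' hE' using fun k => (hE_law k).aemeasurable
  obtain ⟨g', mg', hg'⟩ := hg.aestronglyMeasurable.aemeasurable
  choose gn' mgn' hgn' using fun n => (hgn n).aestronglyMeasurable.aemeasurable
  have hΔ'_law (k : ℕ) : P.map (Δ' k) = σ := by
    rw [← Measure.map_congr (hΔ' k), (hΔ_law k).map_eq]
  have hE'_law (k : ℕ) : P.map (E' k) = expMeasure α := by
    rw [← Measure.map_congr (hE' k), (hE_law k).map_eq]
  have hE'_indep : iIndepFun E' P := (iIndepFun_congr hE').1 hE_indep
  have hΔE' : IndepFun (fun ω k => Δ' k ω) (fun ω k => E' k ω) P := by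
    refine hΔE.congr ?_ ?_
    · filter_upwards [ae_all_iff.2 hΔ'] with ω h using funext h
    · filter_upwards [ae_all_iff.2 hE'] with ω h using funext h
  have hg'i : IntegrableOn g' (Ici 0) := hg.congr hg'
  have hgn'i (n : ℕ) : IntegrableOn (gn' n) (Ici 0) := (hgn n).congr (hgn' n)
  have hIcc {f f' : ℝ → ℝ} (h : f =ᵐ[volume.restrict (Ici 0)] f') (t : ℝ) :
      (volume.restrict (Icc 0 t)).map f = (volume.restrict (Icc 0 t)).map f' :=
    Measure.map_congr (ae_restrict_of_ae_restrict_of_subset Icc_subset_Ici_self h)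
  have hconcl {f f' : ℝ → ℝ} (mf' : Measurable f') (hfi : IntegrableOn f' (Ici 0))
      (hf : f =ᵐ[volume.restrict (Ici 0)] f') :
      (∀ᵐ ω ∂P, Summable (shotTerm Δ E f ω)) ∧ shotNoise Δ E f =ᵐ[P] shotNoise Δ' E' f' := by
    have h := ae_shotTerm_eq hα mE' hE'_law hE'_indep hΔ' hE' hf
    refine ⟨?_, ?_⟩
    · filter_upwards [h, ae_summable_shotTerm hσ_moment hα mΔ' mE' hΔ'_law hE'_law hE'_indep hΔE'
        mf' hfi] with ω h₁ h₂
      rwa [h₁]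
    · filter_upwards [h] with ω hω
      simp only [shotNoise, hω]
  have hn (n : ℕ) := hconcl (mgn' n) (hgn'i n) (hgn' n)
  have h₀ := hconcl mg' hg'i hg'
  refine ⟨fun n => ⟨(hn n).1, (measurable_shotNoise mΔ' mE' (mgn' n)).aemeasurable.congr
    (hn n).2.symm⟩, ⟨h₀.1, (measurable_shotNoise mΔ' mE' mg').aemeasurable.congr h₀.2.symm⟩, ?_⟩
  have hconv' : Tendsto (fun n => eLpNorm (gn' n - g') 1 (volume.restrict (Ici 0)))
      atTop (𝓝 0) := by
    refine hconv.congr fun n => eLpNorm_congr_ae ((hgn' n).sub hg')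
  rw [Measure.map_congr hg'] at hac
  simp_rw [hIcc hg', fun n => hIcc (hgn' n)] at htv
  simp_rw [Measure.map_congr h₀.2, fun n => Measure.map_congr (hn n).2]
  exact tendsto_tvDist_map_shotNoise hσ_zero hσ_moment hα mΔ' mE' hΔ'_law hE'_law hE'_indep hΔE'
    mg' mgn' hg'i hgn'i hconv' hac htv
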